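/- Let $A$ be a (not necessarily unital) complex $C^*$-algebra and let $\widetilde A=\mathbb C 1\dotplus A$ be its unitization (a new unit is adjoined also when $A$ already has one), with scalar map $s\colon\widetilde A\to\mathbb C1\subseteq\widetilde A$, $s(z1+a)=z1$, applied entrywise to matrices. For a $C^*$-algebra $B$ let $\mathcal P_\infty(B)=\bigsqcup_{n\ge1}\{p\in M_n(B)\mid p=p^2=p^*\}$, with direct sum $p\oplus q=\mathrm{diag}(p,q)$; for $p\in M_m(B)$ and $q\in M_n(B)$ in $\mathcal P_\infty(B)$ write $p\sim_0 q$ if there is an $n\times m$ matrix $v$ over $B$ with $v^*v=p$ and $vv^*=q$. For unital $B$, $K_0(B)$ is the Grothendieck group of the commutative monoid $(\mathcal P_\infty(B)/{\sim_0},\oplus)$ and $[p]_0\in K_0(B)$ is the class of $p$; for general $A$, $K_0(A)=\{[p]_0-[s(p)]_0\mid p\in\mathcal P_\infty(\widetilde A)\}\subseteq K_0(\widetilde A)$, and for $p\in\mathcal P_\infty(A)\subseteq\mathcal P_\infty(\widetilde A)$ the class $[p]_0$ lies in $K_0(A)$. A projection is infinite if it is Murray–von Neumann equivalent to a proper subprojection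 of itself. A $C^*$-algebra is finite if its unit, or, when it has no unit, the unit of its unitization, is not an infinite projection. $A$ is stably finite if $M_n(A)$ is finite for every $n\ge1$. Then the following assertions are equivalent: (i) there are $n\ge1$ and a nonzero projection $p\in M_n(A)$ with $[p]_0=0$ in $K_0(A)$; (ii) there are $r\ge1$ and $v\in M_r(\widetilde A)$ with $vv^*=1_r\ne v^*v$; (iii) $A$ is not stably finite. -/

import Mathlib

open scoped Matrix

namespace CStarK

/-! ### Projections in matrix algebras -/

/-- `P_∞(B)`: the disjoint union over `n ≥ 1` of the sets of projections `p = p² = p*` in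
`M_n(B)`.  The involution of `M_n(B)` is the conjugate transpose. -/
structure Proj (B : Type*) [NonUnitalRing B] [StarRing B] where
  /-- the size of the matrix -/
  n : ℕ
  pos : 1 ≤ n
  /-- the underlying matrix -/
  mat : Matrix (Fin n) (Fin n) B
  isProj : IsStarProjection mat

/-- For square matrices `p`, `q`, possibly of different sizes, there is a rectangular matrix `v`
with `v* v = p` and `v v* = q`. -/
def MvN {B : Type*} [NonUnitalRing B] [StarRing B] {m n : Type*} [Fintype m] [Fintype n]
    (p : Matrix m m B) (q : Matrix n n B) : Prop :=
  ∃ v : Matrix n m B, vᴴ * v = p ∧ v * vᴴ = q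

theorem rows_mul_cols {B : Type*} [NonUnitalRing B] {m n k l : Type*} [Fintype n]
    (a : Matrix m n B) (b : Matrix k n B) (c : Matrix n m B) (d : Matrix n l B) :
    Matrix.fromRows a b * Matrix.fromCols c d =
      Matrix.fromBlocks (a * c) (a * d) (b * c) (b * d) := by
  ext (i | i) (j | j) <;> rfl

theorem cols_mul_rows {B : Type*} [NonUnitalRing B] {m n k l : Type*} [Fintype n] [Fintype k]
    (a : Matrix m n B) (b : Matrix m k B) (c : Matrix n l B) (d : Matrix k l B) :
    Matrix.fromCols a b * Matrix.fromRows c d = a * c + b * d := by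
  ext i j
  simp [Matrix.mul_apply, Fintype.sum_sum_type]

section MvN

variable {B : Type*} [NonUnitalRing B] [StarRing B]
variable {m n k l : Type*} [Fintype m] [Fintype n] [Fintype k] [Fintype l]

theorem proj_mul {p : Matrix m m B} (hp : IsStarProjection p) : p * p = p :=
  hp.isIdempotentElem

theorem proj_star {p : Matrix m m B} (hp : IsStarProjection p) : pᴴ = p :=
  hp.isSelfAdjoint

theorem MvN.refl {p : Matrix m m B} (hp : IsStarProjection p) : MvN p p :=
  ⟨p, by rw [proj_star hp, proj_mul hp], by rw [proj_star hp, proj_mul hp]⟩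

theorem MvN.symm {p : Matrix m m B} {q : Matrix n n B} (h : MvN p q) : MvN q p := by
  obtain ⟨v, h1, h2⟩ := h
  exact ⟨vᴴ, by rwa [Matrix.conjTranspose_conjTranspose],
    by rwa [Matrix.conjTranspose_conjTranspose]⟩

theorem MvN.trans {p : Matrix m m B} {q : Matrix n n B} {r : Matrix k k B}
    (hp : IsStarProjection p) (hr : IsStarProjection r)
    (h : MvN p q) (h' : MvN q r) : MvN p r := by
  obtain ⟨v, h1, h2⟩ := h
  obtain ⟨w, h3, h4⟩ := h'
  refine ⟨w * v, ?_, ?_⟩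
  · calc (w * v)ᴴ * (w * v) = vᴴ * (wᴴ * w) * v := by
          simp only [Matrix.conjTranspose_mul, Matrix.mul_assoc]
      _ = (vᴴ * v) * (vᴴ * v) := by rw [h3, ← h2]; simp only [Matrix.mul_assoc]
      _ = p := by rw [h1, proj_mul hp]
  · calc (w * v) * (w * v)ᴴ = w * (v * vᴴ) * wᴴ := by
          simp only [Matrix.conjTranspose_mul, Matrix.mul_assoc]
      _ = (w * wᴴ) * (w * wᴴ) := by rw [h2, ← h3]; simp only [Matrix.mul_assoc]
      _ = r := by rw [h4, proj_mul hr]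

theorem MvN.submatrix (e : n ≃ m) {p : Matrix m m B} (hp : IsStarProjection p) :
    MvN p (p.submatrix e e) := by
  refine ⟨p.submatrix e id, ?_, ?_⟩
  · rw [Matrix.conjTranspose_submatrix, proj_star hp, Matrix.submatrix_mul_equiv, proj_mul hp,
      Matrix.submatrix_id_id]
  · rw [Matrix.conjTranspose_submatrix, proj_star hp,
      ← Matrix.submatrix_mul p p e id e Function.bijective_id, proj_mul hp]

theorem isStarProjection_submatrix (e : n ≃ m) {p : Matrix m m B} (hp : IsStarProjection p) :
    IsStarProjection (p.submatrix e e) := by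
  refine ⟨?_, ?_⟩
  · change p.submatrix e e * p.submatrix e e = _
    rw [Matrix.submatrix_mul_equiv, proj_mul hp]
  · change (p.submatrix e e)ᴴ = _
    rw [Matrix.conjTranspose_submatrix, proj_star hp]

theorem isStarProjection_fromBlocks {p : Matrix m m B} {q : Matrix n n B}
    (hp : IsStarProjection p) (hq : IsStarProjection q) :
    IsStarProjection (Matrix.fromBlocks p 0 0 q) := by
  refine ⟨?_, ?_⟩
  · change Matrix.fromBlocks p 0 0 q * Matrix.fromBlocks p 0 0 q = _
    simp [Matrix.fromBlocks_multiply, proj_mul hp, proj_mul hq]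
  · change (Matrix.fromBlocks p 0 0 q)ᴴ = _
    simp [Matrix.fromBlocks_conjTranspose, proj_star hp, proj_star hq]

theorem MvN.fromBlocks {p : Matrix m m B} {q : Matrix n n B} {p' : Matrix k k B}
    {q' : Matrix l l B} (h : MvN p p') (h' : MvN q q') :
    MvN (Matrix.fromBlocks p 0 0 q) (Matrix.fromBlocks p' 0 0 q') := by
  obtain ⟨v, h1, h2⟩ := h
  obtain ⟨w, h3, h4⟩ := h'
  exact ⟨Matrix.fromBlocks v 0 0 w,
    by simp [Matrix.fromBlocks_multiply, Matrix.fromBlocks_conjTranspose, h1, h3],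
    by simp [Matrix.fromBlocks_multiply, Matrix.fromBlocks_conjTranspose, h2, h4]⟩

theorem MvN.zero_zero : MvN (0 : Matrix m m B) (0 : Matrix n n B) := ⟨0, by simp, by simp⟩

theorem MvN.fromBlocks_zero {p : Matrix m m B} (hp : IsStarProjection p) :
    MvN (Matrix.fromBlocks p 0 0 (0 : Matrix n n B)) p := by
  refine ⟨Matrix.fromCols p 0, ?_, ?_⟩
  · rw [Matrix.conjTranspose_fromCols_eq_fromRows_conjTranspose, rows_mul_cols,
      proj_star hp, proj_mul hp]
    simp
  · rw [Matrix.conjTranspose_fromCols_eq_fromRows_conjTranspose, cols_mul_rows,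
      proj_star hp, proj_mul hp]
    simp

theorem MvN.fromBlocks_orthogonal {p q : Matrix m m B} (hp : IsStarProjection p)
    (hq : IsStarProjection q) (hpq : p * q = 0) (hqp : q * p = 0) :
    MvN (Matrix.fromBlocks p 0 0 q) (p + q) := by
  refine ⟨Matrix.fromCols p q, ?_, ?_⟩
  · rw [Matrix.conjTranspose_fromCols_eq_fromRows_conjTranspose, rows_mul_cols,
      proj_star hp, proj_mul hp, proj_star hq, proj_mul hq, hpq, hqp]
  · rw [Matrix.conjTranspose_fromCols_eq_fromRows_conjTranspose, cols_mul_rows,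
      proj_star hp, proj_mul hp, proj_star hq, proj_mul hq]

end MvN

namespace Proj

variable {B : Type*} [NonUnitalRing B] [StarRing B]

theorem mk_congr {n : ℕ} {h h' : 1 ≤ n} {a b : Matrix (Fin n) (Fin n) B}
    {ha : IsStarProjection a} {hb : IsStarProjection b} (e : a = b) :
    Proj.mk n h a ha = Proj.mk n h' b hb := by
  subst e
  rfl

/-- The direct sum `p ⊕ q = diag(p, q)`. -/
def oplus (p q : Proj B) : Proj B where
  n := p.n + q.n
  pos := le_trans p.pos (Nat.le_add_right _ _)
  mat := (Matrix.fromBlocks p.mat 0 0 q.mat).submatrix finSumFinEquiv.symm finSumFinEquiv.symm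
  isProj := isStarProjection_submatrix _ (isStarProjection_fromBlocks p.isProj q.isProj)

/-- The zero projection in `M_n(B)`. -/
def zero (B : Type*) [NonUnitalRing B] [StarRing B] (n : ℕ) (hn : 1 ≤ n) : Proj B where
  n := n
  pos := hn
  mat := 0
  isProj := .zero _

/-- Entrywise image of a projection under a map preserving sums, products and involution. -/
def map {C : Type*} [NonUnitalRing C] [StarRing C] [Module ℂ B] [Module ℂ C]
    (f : B →⋆ₙₐ[ℂ] C) (p : Proj B) : Proj C where
  n := p.n
  pos := p.pos
  mat := p.mat.map f
  isProj := by
    refine ⟨?_, ?_⟩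
    · change p.mat.map f * p.mat.map f = _
      rw [← Matrix.map_mul, proj_mul p.isProj]
    · change (p.mat.map f)ᴴ = _
      rw [← Matrix.conjTranspose_map f (fun x => map_star f x), proj_star p.isProj]

/-- The equivalence relation `∼₀` on `P_∞(B)`. -/
instance setoid (B : Type*) [NonUnitalRing B] [StarRing B] : Setoid (Proj B) where
  r p q := MvN p.mat q.mat
  iseqv :=
    { refl := fun p => MvN.refl p.isProj
      symm := fun h => h.symm
      trans := fun {p _ r} h h' => MvN.trans p.isProj r.isProj h h' }

theorem equiv_def {p q : Proj B} : p ≈ q ↔ MvN p.mat q.mat := Iff.rfl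

theorem mvN_oplus (p q : Proj B) :
    MvN (Matrix.fromBlocks p.mat 0 0 q.mat) (p.oplus q).mat :=
  MvN.submatrix _ (isStarProjection_fromBlocks p.isProj q.isProj)

theorem oplus_congr {p q p' q' : Proj B} (h : p ≈ p') (h' : q ≈ q') :
    p.oplus q ≈ p'.oplus q' := by
  have hs := isStarProjection_fromBlocks p.isProj q.isProj
  exact MvN.trans (p.oplus q).isProj (p'.oplus q').isProj (mvN_oplus p q).symm
    (MvN.trans hs (p'.oplus q').isProj (MvN.fromBlocks h h') (mvN_oplus p' q'))

theorem oplus_comm (p q : Proj B) : p.oplus q ≈ q.oplus p := by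
  have hs := isStarProjection_fromBlocks p.isProj q.isProj
  refine MvN.trans (p.oplus q).isProj (q.oplus p).isProj (mvN_oplus p q).symm
    (MvN.trans hs (q.oplus p).isProj ?_ (mvN_oplus q p))
  have h := MvN.submatrix (Equiv.sumComm (Fin q.n) (Fin p.n)) hs
  have e : (Matrix.fromBlocks p.mat 0 0 q.mat).submatrix (Equiv.sumComm (Fin q.n) (Fin p.n))
      (Equiv.sumComm (Fin q.n) (Fin p.n)) = Matrix.fromBlocks q.mat 0 0 p.mat := by
    ext (i | i) (j | j) <;> rfl
  rwa [e] at h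

theorem oplus_assoc (p q r : Proj B) : (p.oplus q).oplus r ≈ p.oplus (q.oplus r) := by
  have hpq := isStarProjection_fromBlocks p.isProj q.isProj
  have hqr := isStarProjection_fromBlocks q.isProj r.isProj
  have h1 : MvN ((p.oplus q).oplus r).mat
      (Matrix.fromBlocks (Matrix.fromBlocks p.mat 0 0 q.mat) 0 0 r.mat) :=
    MvN.trans ((p.oplus q).oplus r).isProj (isStarProjection_fromBlocks hpq r.isProj)
      (mvN_oplus (p.oplus q) r).symm
      (MvN.fromBlocks (mvN_oplus p q).symm (MvN.refl r.isProj))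
  have h2 : MvN (Matrix.fromBlocks p.mat 0 0 (Matrix.fromBlocks q.mat 0 0 r.mat))
      (p.oplus (q.oplus r)).mat :=
    MvN.trans (isStarProjection_fromBlocks p.isProj hqr) (p.oplus (q.oplus r)).isProj
      (MvN.fromBlocks (MvN.refl p.isProj) (mvN_oplus q r)) (mvN_oplus p (q.oplus r))
  have h := MvN.submatrix (Equiv.sumAssoc (Fin p.n) (Fin q.n) (Fin r.n)).symm
    (isStarProjection_fromBlocks hpq r.isProj)
  have e : (Matrix.fromBlocks (Matrix.fromBlocks p.mat 0 0 q.mat) 0 0 r.mat).submatrix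
      (Equiv.sumAssoc (Fin p.n) (Fin q.n) (Fin r.n)).symm
      (Equiv.sumAssoc (Fin p.n) (Fin q.n) (Fin r.n)).symm =
      Matrix.fromBlocks p.mat 0 0 (Matrix.fromBlocks q.mat 0 0 r.mat) := by
    ext (i | i | i) (j | j | j) <;> rfl
  rw [e] at h
  exact MvN.trans ((p.oplus q).oplus r).isProj (p.oplus (q.oplus r)).isProj h1
    (MvN.trans (isStarProjection_fromBlocks hpq r.isProj) (p.oplus (q.oplus r)).isProj h h2)

theorem zero_equiv (m n : ℕ) (hm : 1 ≤ m) (hn : 1 ≤ n) : zero B m hm ≈ zero B n hn :=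
  MvN.zero_zero

theorem oplus_zero (p : Proj B) (n : ℕ) (hn : 1 ≤ n) : p.oplus (zero B n hn) ≈ p :=
  MvN.trans (p.oplus (zero B n hn)).isProj p.isProj (mvN_oplus p _).symm
    (MvN.fromBlocks_zero p.isProj)

variable {C : Type*} [NonUnitalRing C] [StarRing C] [Module ℂ B] [Module ℂ C]

theorem map_oplus (f : B →⋆ₙₐ[ℂ] C) (p q : Proj B) :
    (p.oplus q).map f = (p.map f).oplus (q.map f) := by
  refine mk_congr ?_
  change ((Matrix.fromBlocks p.mat 0 0 q.mat).map f).submatrix _ _ = _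
  rw [Matrix.fromBlocks_map, Matrix.map_zero _ (map_zero f), Matrix.map_zero _ (map_zero f)]
  rfl

end Proj

/-- The commutative monoid `D(B) = P_∞(B)/∼₀`, with addition induced by `⊕`. -/
def ProjClass (B : Type*) [NonUnitalRing B] [StarRing B] : Type _ := Quotient (Proj.setoid B)

/-- The class of `p` in `D(B)`. -/
def ProjClass.mk {B : Type*} [NonUnitalRing B] [StarRing B] (p : Proj B) : ProjClass B :=
  Quotient.mk (Proj.setoid B) p

instance (B : Type*) [NonUnitalRing B] [StarRing B] : Add (ProjClass B) where
  add := Quotient.map₂ Proj.oplus fun _ _ h _ _ h' => Proj.oplus_congr h h'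

instance (B : Type*) [NonUnitalRing B] [StarRing B] : Zero (ProjClass B) where
  zero := ProjClass.mk (Proj.zero B 1 le_rfl)

instance (B : Type*) [NonUnitalRing B] [StarRing B] : AddCommMonoid (ProjClass B) where
  add_assoc a b c := by
    induction a, b, c using Quotient.inductionOn₃
    exact Quotient.sound (Proj.oplus_assoc _ _ _)
  add_comm a b := by
    induction a, b using Quotient.inductionOn₂
    exact Quotient.sound (Proj.oplus_comm _ _)
  zero_add a := by
    induction a using Quotient.inductionOn
    exact Quotient.sound (Setoid.trans (Proj.oplus_comm _ _) (Proj.oplus_zero _ _ _))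
  add_zero a := by
    induction a using Quotient.inductionOn
    exact Quotient.sound (Proj.oplus_zero _ _ _)
  nsmul := nsmulRec

/-- `K₀` of a unital `C*`-algebra `B`: the Grothendieck group of `D(B)`. -/
abbrev K0Unital (B : Type*) [Ring B] [StarRing B] : Type _ :=
  Algebra.GrothendieckAddGroup (ProjClass B)

/-- The class `[p]₀ ∈ K₀(B)` of a projection `p ∈ P_∞(B)`, for unital `B`. -/
def K0Unital.cls {B : Type*} [Ring B] [StarRing B] (p : Proj B) : K0Unital B :=
  Algebra.GrothendieckAddGroup.of (ProjClass.mk p)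

namespace K0Unital

variable {B : Type*} [Ring B] [StarRing B]

theorem cls_eq {p q : Proj B} (h : p ≈ q) : cls p = cls q :=
  congrArg Algebra.GrothendieckAddGroup.of
    (Quotient.sound h : (ProjClass.mk p : ProjClass B) = ProjClass.mk q)

theorem cls_oplus (p q : Proj B) : cls (p.oplus q) = cls p + cls q :=
  map_add Algebra.GrothendieckAddGroup.of (ProjClass.mk p) (ProjClass.mk q)

theorem cls_zero (n : ℕ) (hn : 1 ≤ n) : cls (Proj.zero B n hn) = 0 :=
  (cls_eq (Proj.zero_equiv n 1 hn le_rfl)).trans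
    (map_zero (Algebra.GrothendieckAddGroup.of (M := ProjClass B)))

end K0Unital

/-! ### `K₀` of an arbitrary `C*`-algebra -/

section K0

variable (A : Type*) [NonUnitalCStarAlgebra A]

/-- The scalar map `s : Ã → ℂ1 ⊆ Ã`, `a + z1 ↦ z1`. -/
noncomputable def scalarMap : Unitization ℂ A →⋆ₙₐ[ℂ] Unitization ℂ A where
  toFun x := Unitization.inl x.fst
  map_smul' z x := by ext <;> simp
  map_zero' := by simp
  map_add' x y := by simp
  map_mul' x y := by simp
  map_star' x := by ext <;> simp

theorem scalarMap_apply (x : Unitization ℂ A) : scalarMap A x = Unitization.inl x.fst := rfl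

theorem map_scalarMap_one {n : ℕ} :
    (1 : Matrix (Fin n) (Fin n) (Unitization ℂ A)).map (scalarMap A) = 1 :=
  Matrix.map_one _ (map_zero _) (by simp [scalarMap_apply])

/-- `1_n - p` for a projection `p ∈ M_n(Ã)`. -/
noncomputable def compl {A : Type*} [NonUnitalCStarAlgebra A] (p : Proj (Unitization ℂ A)) :
    Proj (Unitization ℂ A) where
  n := p.n
  pos := p.pos
  mat := 1 - p.mat
  isProj := p.isProj.one_sub

/-- The unit `1_n ∈ M_n(Ã)`. -/
noncomputable def oneProj (n : ℕ) (hn : 1 ≤ n) : Proj (Unitization ℂ A) where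
  n := n
  pos := hn
  mat := 1
  isProj := .one _

variable {A}

theorem cls_add_compl (p : Proj (Unitization ℂ A)) :
    K0Unital.cls p + K0Unital.cls (compl p) = K0Unital.cls (oneProj A p.n p.pos) := by
  rw [← K0Unital.cls_oplus]
  refine K0Unital.cls_eq ?_
  have h := MvN.fromBlocks_orthogonal p.isProj (compl p).isProj
    (by change p.mat * (1 - p.mat) = 0; rw [mul_sub, mul_one, proj_mul p.isProj, sub_self])
    (by change (1 - p.mat) * p.mat = 0; rw [sub_mul, one_mul, proj_mul p.isProj, sub_self])
  have e : p.mat + (1 - p.mat) = 1 := by abel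
  change MvN _ (p.mat + (1 - p.mat)) at h
  rw [e] at h
  exact MvN.trans (p.oplus (compl p)).isProj (oneProj A p.n p.pos).isProj
    (Proj.mvN_oplus p (compl p)).symm h

theorem map_scalarMap_compl (p : Proj (Unitization ℂ A)) :
    (compl p).map (scalarMap A) = compl (p.map (scalarMap A)) := by
  refine Proj.mk_congr ?_
  change (1 - p.mat).map (scalarMap A) = 1 - p.mat.map (scalarMap A)
  rw [Matrix.map_sub _ (map_sub _), map_scalarMap_one]

variable (A)

/-- `K₀(A) = {[p]₀ - [s(p)]₀ | p ∈ P_∞(Ã)} ⊆ K₀(Ã)`. -/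
noncomputable def K0 : AddSubgroup (K0Unital (Unitization ℂ A)) where
  carrier := {x | ∃ p : Proj (Unitization ℂ A),
    x = K0Unital.cls p - K0Unital.cls (p.map (scalarMap A))}
  add_mem' := by
    rintro _ _ ⟨p, rfl⟩ ⟨q, rfl⟩
    refine ⟨p.oplus q, ?_⟩
    rw [Proj.map_oplus, K0Unital.cls_oplus, K0Unital.cls_oplus]
    abel
  zero_mem' := by
    refine ⟨oneProj A 1 le_rfl, ?_⟩
    have : (oneProj A 1 le_rfl).map (scalarMap A) = oneProj A 1 le_rfl :=
      Proj.mk_congr (map_scalarMap_one A)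
    rw [this, sub_self]
  neg_mem' := by
    rintro _ ⟨p, rfl⟩
    refine ⟨compl p, ?_⟩
    have h1 := eq_sub_of_add_eq' (cls_add_compl p)
    have h2 := eq_sub_of_add_eq' (cls_add_compl (p.map (scalarMap A)))
    rw [map_scalarMap_compl, h1, h2]
    change _ = K0Unital.cls (oneProj A p.n p.pos) - _ - (K0Unital.cls (oneProj A p.n p.pos) - _)
    abel

variable {A}

/-- The image in `P_∞(Ã)` of a projection `p ∈ P_∞(A)`, under the inclusion
`M_n(A) ⊆ M_n(Ã)`. -/
noncomputable def toUnitization (p : Proj A) : Proj (Unitization ℂ A) :=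
  p.map (Unitization.inrNonUnitalStarAlgHom ℂ A)

theorem map_scalarMap_toUnitization (p : Proj A) :
    (toUnitization p).map (scalarMap A) = Proj.zero _ p.n p.pos := by
  refine Proj.mk_congr ?_
  change (p.mat.map (Unitization.inrNonUnitalStarAlgHom ℂ A)).map (scalarMap A) = 0
  ext i j <;> simp [scalarMap_apply]

/-- The class `[p]₀ ∈ K₀(A)` of a projection `p ∈ P_∞(A)`. -/
noncomputable def K0.cls (p : Proj A) : K0 A :=
  ⟨K0Unital.cls (toUnitization p), toUnitization p, by
    rw [map_scalarMap_toUnitization, K0Unital.cls_zero, sub_zero]⟩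

end K0

/-! ### Finiteness -/

/-- A projection `p` is infinite if it is Murray-von Neumann equivalent to a proper
subprojection: `v* v = p`, `v v* = q`, `q ≤ p` (that is, `p q = q`), `q ≠ p`. -/
def IsInfiniteProj {B : Type*} [Mul B] [Star B] (p : B) : Prop :=
  IsStarProjection p ∧
    ∃ q : B, IsStarProjection q ∧ (∃ v : B, star v * v = p ∧ v * star v = q) ∧ p * q = q ∧ q ≠ p

/-- `e` is a unit of the (not assumed unital) algebra `B`. -/
def IsUnitElem {B : Type*} [Mul B] (e : B) : Prop := ∀ x : B, e * x = x ∧ x * e = x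

/-- A `C*`-algebra with a unit is finite if its unit is a finite (not infinite) projection;
a `C*`-algebra without a unit is finite if the unit of its unitization is a finite projection. -/
def IsFiniteAlg (B : Type*) [NonUnitalRing B] [StarRing B] [Module ℂ B] : Prop :=
  (∀ e : B, IsUnitElem e → ¬ IsInfiniteProj e) ∧
    ((¬ ∃ e : B, IsUnitElem e) → ¬ IsInfiniteProj (1 : Unitization ℂ B))

/-- A `C*`-algebra `A` is stably finite if `M_n(A)` is finite for every `n ≥ 1`. -/
def IsStablyFinite (A : Type*) [NonUnitalCStarAlgebra A] : Prop :=
  ∀ n : ℕ, 1 ≤ n → IsFiniteAlg (Matrix (Fin n) (Fin n) A)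

end CStarK

/-! A nonzero projection with trivial class and a non-unitary coisometry encode the same data. If
`[p]₀ = 0`, stabilising gives `p ⊕ 1_r ∼₀ 1_r`. A partial isometry implementing this is a row `[a
b]`, and `b*` is a coisometry with defect equivalent to `p`, hence not unitary
(`exists_coisometry_of_mvN`). Conversely, for a coisometry `v` the defect `1 - v*v` satisfies `(1 -
v*v) ⊕ 1 ∼₀ (1 - v*v) ⊕ v*v ∼₀ 1`, so its class vanishes.

The passage between `Ã` and `A` rests on one fact: the scalar part of a coisometry over `Ã` is a
coisometry over `ℂ`, hence unitary by finite dimensionality. Thus `1 - v*v` has entries in `A`, and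
dividing `v` by its scalar part puts it in the form `1 + a` with `a` over `A`. The conditions on `a`
do not mention a unit, so they treat unital and non-unital matrix algebras alike
(`not_isFiniteAlg_iff`). -/

namespace CStarK

/-- `a` is such that `1 + a` is a non-unitary coisometry in every unital star ring containing `a`,
expressed without reference to a unit. -/
def IsProperQuasiCoisometry {B : Type*} [NonUnitalRing B] [StarRing B] (a : B) : Prop :=
  a + star a + a * star a = 0 ∧ a + star a + star a * a ≠ 0

/-! ### Coisometries written as `1 + c`. -/

section Ring

variable {C : Type*} [Ring C] [StarRing C]

theorem one_add_mul_star_eq_one_iff (c : C) :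
    (1 + c) * star (1 + c) = 1 ↔ c + star c + c * star c = 0 := by
  have : (1 + c) * star (1 + c) = 1 + (c + star c + c * star c) := by
    rw [star_add, star_one]; noncomm_ring
  rw [this, add_eq_left]

theorem star_mul_one_add_eq_one_iff (c : C) :
    star (1 + c) * (1 + c) = 1 ↔ c + star c + star c * c = 0 := by
  have : star (1 + c) * (1 + c) = 1 + (c + star c + star c * c) := by
    rw [star_add, star_one]; noncomm_ring
  rw [this, add_eq_left]

theorem isProperQuasiCoisometry_iff (c : C) :
    IsProperQuasiCoisometry c ↔ (1 + c) * star (1 + c) = 1 ∧ star (1 + c) * (1 + c) ≠ 1 := by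
  rw [IsProperQuasiCoisometry, one_add_mul_star_eq_one_iff, Ne, Ne, star_mul_one_add_eq_one_iff]

theorem isStarProjection_star_mul_self {v : C} (h : v * star v = 1) :
    IsStarProjection (star v * v) := by
  refine ⟨?_, ?_⟩
  · change star v * v * (star v * v) = star v * v
    rw [mul_assoc, ← mul_assoc v, h, one_mul]
  · change star (star v * v) = star v * v
    rw [star_mul, star_star]

theorem isInfiniteProj_one_iff :
    IsInfiniteProj (1 : C) ↔ ∃ v : C, v * star v = 1 ∧ star v * v ≠ 1 := by
  constructor
  · rintro ⟨-, q, -, ⟨v, h1, rfl⟩, -, h3⟩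
    exact ⟨star v, by rwa [star_star], by rwa [star_star]⟩
  · rintro ⟨v, h1, h2⟩
    exact ⟨.one _, star v * v, isStarProjection_star_mul_self h1,
      ⟨star v, by rwa [star_star], by rw [star_star]⟩, one_mul _, h2⟩

end Ring

/-! ### Finiteness expressed without a unit. -/

section NonUnitalRing

variable {B : Type*} [NonUnitalRing B] [StarRing B]

theorem IsProperQuasiCoisometry.map_iff {C F : Type*} [NonUnitalRing C] [StarRing C]
    [FunLike F B C] [NonUnitalRingHomClass F B C] [StarHomClass F B C] {f : F}
    (hf : Function.Injective f) {a : B} :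
    IsProperQuasiCoisometry (f a) ↔ IsProperQuasiCoisometry a := by
  simp only [IsProperQuasiCoisometry, ← map_star, ← map_mul, ← map_add, Ne,
    map_eq_zero_iff f hf]

theorem IsUnitElem.star_eq {e : B} (he : IsUnitElem e) : star e = e := by
  have h := (he (star e)).1
  have h' := congrArg star h
  rw [star_mul, star_star] at h'
  rw [← h, h']

/-- The substitution `a ↦ e + a` works for the algebra's own unit `e` exactly as for an adjoined
one. -/
theorem IsUnitElem.isInfiniteProj_iff {e : B} (he : IsUnitElem e) :
    IsInfiniteProj e ↔ ∃ a : B, IsProperQuasiCoisometry a := by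
  have hs := he.star_eq
  have key1 (a : B) : (e + a) * star (e + a) = e + (a + star a + a * star a) := by
    rw [star_add, hs, add_mul, (he _).1, mul_add, (he a).2]; abel
  have key2 (a : B) : star (e + a) * (e + a) = e + (a + star a + star a * a) := by
    rw [star_add, hs, add_mul, (he _).1, mul_add, (he (star a)).2]; abel
  constructor
  · rintro ⟨-, q, -, ⟨v, h1, rfl⟩, -, h3⟩
    have hv : e + (star v - e) = star v := by abel
    have h1' := key1 (star v - e)
    have h2' := key2 (star v - e)
    rw [hv, star_star] at h1' h2'
    -- Infiniteness supplies an isometry, so its adjoint is the coisometry to be written as `e + a`.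
    refine ⟨star v - e, ?_, fun h => h3 ?_⟩
    · exact add_eq_left.1 (h1'.symm.trans h1)
    · rw [h2', h, add_zero]
  · rintro ⟨a, h1, h2⟩
    have h1' : (e + a) * star (e + a) = e := by rw [key1, h1, add_zero]
    refine ⟨⟨(he e).1, hs⟩, star (e + a) * (e + a), ⟨?_, ?_⟩,
      ⟨star (e + a), by rwa [star_star], by rw [star_star]⟩, (he _).1, ?_⟩
    · change star (e + a) * (e + a) * (star (e + a) * (e + a)) = _
      rw [mul_assoc, ← mul_assoc (e + a), h1', (he _).1]
    · change star (star (e + a) * (e + a)) = _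
      rw [star_mul, star_star]
    · rw [key2]
      exact fun h => h2 (add_eq_left.1 h)

variable [Module ℂ B] [IsScalarTower ℂ B B] [SMulCommClass ℂ B B] [StarModule ℂ B]

/-- The scalar part of a coisometry has modulus one. Multiplying by its conjugate normalises it to
`1` and changes neither `v * star v` nor `star v * v`. -/
theorem isInfiniteProj_one_unitization_iff :
    IsInfiniteProj (1 : Unitization ℂ B) ↔ ∃ a : B, IsProperQuasiCoisometry a := by
  have hinj : Function.Injective (Unitization.inrNonUnitalStarAlgHom ℂ B) :=
    Unitization.inr_injective
  rw [isInfiniteProj_one_iff]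
  constructor
  · rintro ⟨v, h1, h2⟩
    have hz : v.fst * star v.fst = 1 := by simpa using congrArg (fun x : Unitization ℂ B => x.fst) h1
    have hz' : star v.fst * v.fst = 1 := by rwa [mul_comm]
    refine ⟨star v.fst • v.snd, (IsProperQuasiCoisometry.map_iff hinj).1 ?_⟩
    have hw : 1 + Unitization.inrNonUnitalStarAlgHom ℂ B (star v.fst • v.snd) =
        star v.fst • v := by
      ext
      · simpa using hz'.symm
      · simp
    rw [isProperQuasiCoisometry_iff, hw, star_smul, star_star, smul_mul_smul_comm,
      smul_mul_smul_comm, hz, hz', h1, one_smul, one_smul]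
    exact ⟨rfl, h2⟩
  · rintro ⟨a, ha⟩
    exact ⟨_, (isProperQuasiCoisometry_iff _).1 ((IsProperQuasiCoisometry.map_iff hinj).2 ha)⟩

/-- Both clauses of the definition, for algebras with and without a unit, reduce to the same
condition on elements of `B`. -/
theorem not_isFiniteAlg_iff :
    ¬ IsFiniteAlg B ↔ ∃ a : B, IsProperQuasiCoisometry a := by
  rw [IsFiniteAlg, isInfiniteProj_one_unitization_iff]
  by_cases h : ∃ e : B, IsUnitElem e
  · obtain ⟨e, he⟩ := h
    constructor
    · intro hn
      by_contra ha
      exact hn ⟨fun e' he' hi => ha (he'.isInfiniteProj_iff.1 hi), fun _ => ha⟩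
    · exact fun ha hf => hf.1 e he (he.isInfiniteProj_iff.2 ha)
  · constructor
    · intro hn
      by_contra ha
      exact hn ⟨fun e he => (h ⟨e, he⟩).elim, fun _ => ha⟩
    · exact fun ha hf => hf.2 h ha

end NonUnitalRing

/-! ### Removing the scalar part of a coisometry over the unitization. -/

section Matrix

variable {A : Type*} [NonUnitalCStarAlgebra A] {n : Type*} [Fintype n]

/-- The entrywise inclusion `M_n(A) ⊆ M_n(Ã)`. -/
noncomputable def matrixInr (A : Type*) [NonUnitalCStarAlgebra A] (n : Type*) [Fintype n] :
    Matrix n n A →⋆ₙₐ[ℂ] Matrix n n (Unitization ℂ A) where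
  toFun a := a.map (Unitization.inrNonUnitalStarAlgHom ℂ A)
  map_smul' z a := by ext <;> simp
  map_zero' := by ext <;> simp
  map_add' a b := by ext <;> simp
  map_mul' a b := Matrix.map_mul
  map_star' a := by ext <;> simp [Matrix.star_apply]

theorem matrixInr_injective :
    Function.Injective (matrixInr A n) :=
  Matrix.map_injective Unitization.inr_injective

variable [DecidableEq n]

/-- The entrywise scalar part `M_n(Ã) → M_n(ℂ)`. -/
noncomputable def matrixFst (A : Type*) [NonUnitalCStarAlgebra A] (n : Type*) [Fintype n]
    [DecidableEq n] : Matrix n n (Unitization ℂ A) →+* Matrix n n ℂ :=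
  (Unitization.fstHom ℂ A).toRingHom.mapMatrix

theorem matrixFst_apply (v : Matrix n n (Unitization ℂ A)) (i j : n) :
    matrixFst A n v i j = (v i j).fst := rfl

theorem matrixFst_star (v : Matrix n n (Unitization ℂ A)) :
    matrixFst A n (star v) = star (matrixFst A n v) := by
  ext i j
  simp [matrixFst_apply, Matrix.star_apply]

/-- One-sided inverses of complex square matrices are two-sided; this is the only place where finite
dimensionality enters. -/
theorem matrixFst_star_mul_self {v : Matrix n n (Unitization ℂ A)} (h : v * star v = 1) :
    star (matrixFst A n v) * matrixFst A n v = 1 := by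
  rw [mul_eq_one_comm, ← matrixFst_star, ← map_mul, h, map_one]

theorem exists_matrixInr_eq {v : Matrix n n (Unitization ℂ A)} (h : matrixFst A n v = 0) :
    ∃ a, matrixInr A n a = v := by
  refine ⟨v.map fun x => x.snd, ?_⟩
  ext i j
  · exact (congrFun (congrFun h i) j).symm
  · rfl

/-- The matrix version of the normalisation above: with `u` the unitary scalar part of `v`, the
coisometry `star u * v` has scalar part `1`, so it differs from `1` by a matrix over `A`. -/
theorem exists_isProperQuasiCoisometry_matrix_iff :
    (∃ v : Matrix n n (Unitization ℂ A), v * star v = 1 ∧ star v * v ≠ 1) ↔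
      ∃ a : Matrix n n A, IsProperQuasiCoisometry a := by
  constructor
  · rintro ⟨v, h1, h2⟩
    let ι : ℂ →+* Unitization ℂ A := Unitization.inlRingHom ℂ A
    let u : Matrix n n (Unitization ℂ A) := ι.mapMatrix (matrixFst A n v)
    have hstar : star u = ι.mapMatrix (star (matrixFst A n v)) := by
      ext i j <;> simp [u, ι, Matrix.star_apply]
    have hu : star u * u = 1 := by
      rw [hstar, ← map_mul, matrixFst_star_mul_self h1, map_one]
    have hu' : u * star u = 1 := by
      rw [hstar, ← map_mul, mul_eq_one_comm.1 (matrixFst_star_mul_self h1), map_one]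
    have hfu : matrixFst A n u = matrixFst A n v := by
      ext i j; simp [u, ι, matrixFst_apply]
    obtain ⟨a, ha⟩ : ∃ a, matrixInr A n a = star u * v - 1 := by
      apply exists_matrixInr_eq
      rw [map_sub, map_mul, matrixFst_star, hfu, matrixFst_star_mul_self h1, map_one, sub_self]
    refine ⟨a, (IsProperQuasiCoisometry.map_iff (f := matrixInr A n) matrixInr_injective).1 ?_⟩
    rw [isProperQuasiCoisometry_iff, ha, add_sub_cancel, star_mul, star_star]
    constructor
    · rw [mul_assoc, ← mul_assoc v, h1, one_mul, hu]
    -- The unitary cancels in the middle, leaving `star v * v`.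
    · rwa [mul_assoc, ← mul_assoc u, hu', one_mul]
  · rintro ⟨a, ha⟩
    exact ⟨_, (isProperQuasiCoisometry_iff _).1
      ((IsProperQuasiCoisometry.map_iff (f := matrixInr A n) matrixInr_injective).2 ha)⟩

theorem exists_coisometry_iff_not_isStablyFinite :
    (∃ r : ℕ, 1 ≤ r ∧ ∃ v : Matrix (Fin r) (Fin r) (Unitization ℂ A),
      v * star v = 1 ∧ star v * v ≠ 1) ↔ ¬ IsStablyFinite A := by
  simp only [IsStablyFinite, exists_isProperQuasiCoisometry_matrix_iff, not_forall,
    not_isFiniteAlg_iff, exists_prop]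

end Matrix

/-! ### Vanishing classes in `K₀` and coisometries. -/

section K0

/-- A Murray-von Neumann equivalence of `p ⊕ 1` with `1` yields a coisometry with defect
equivalent to `p`. -/
theorem exists_coisometry_of_mvN {B : Type*} [Ring B] [StarRing B] {m n : Type*} [Fintype m]
    [Fintype n] [DecidableEq n] {p : Matrix m m B} (hp : IsStarProjection p) (hp0 : p ≠ 0)
    (h : MvN (Matrix.fromBlocks p 0 0 (1 : Matrix n n B)) (1 : Matrix n n B)) :
    ∃ v : Matrix n n B, v * star v = 1 ∧ star v * v ≠ 1 := by
  obtain ⟨w, h1, h2⟩ := h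
  obtain ⟨a, b, rfl⟩ : ∃ a b, w = Matrix.fromCols a b :=
    ⟨w.toCols₁, w.toCols₂, (Matrix.fromCols_toCols w).symm⟩
  rw [Matrix.conjTranspose_fromCols_eq_fromRows_conjTranspose, rows_mul_cols,
    Matrix.fromBlocks_inj] at h1
  rw [Matrix.conjTranspose_fromCols_eq_fromRows_conjTranspose, cols_mul_rows] at h2
  obtain ⟨ha, -, -, hb⟩ := h1
  refine ⟨bᴴ, by rwa [Matrix.star_eq_conjTranspose, Matrix.conjTranspose_conjTranspose], ?_⟩
  rw [Matrix.star_eq_conjTranspose, Matrix.conjTranspose_conjTranspose]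
  intro hbb
  -- If `b * bᴴ = 1`, then `a * aᴴ = 0`, which kills `p = p * p = aᴴ * (a * aᴴ) * a`.
  rw [hbb, add_eq_right] at h2
  apply hp0
  calc p = aᴴ * a * (aᴴ * a) := by rw [ha, proj_mul hp]
    _ = aᴴ * (a * aᴴ) * a := by simp only [Matrix.mul_assoc]
    _ = 0 := by rw [h2]; simp

variable {A : Type*} [NonUnitalCStarAlgebra A]

theorem K0Unital.cls_eq_iff {B : Type*} [Ring B] [StarRing B] {p q : Proj B} :
    cls p = cls q ↔ ∃ c : Proj B, c.oplus p ≈ c.oplus q := by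
  have := (AddLocalization.addMonoidOf (⊤ : AddSubmonoid (ProjClass B))).eq_iff_exists
    (x := ProjClass.mk p) (y := ProjClass.mk q)
  refine Iff.trans this ⟨?_, ?_⟩
  · rintro ⟨⟨c, _⟩, hc⟩
    obtain ⟨c, rfl⟩ := Quotient.exists_rep c
    exact ⟨c, Quotient.exact hc⟩
  · rintro ⟨c, hc⟩
    exact ⟨⟨ProjClass.mk c, trivial⟩, Quotient.sound hc⟩

theorem Proj.oplus_compl_equiv (p : Proj (Unitization ℂ A)) :
    p.oplus (compl p) ≈ oneProj A p.n p.pos := by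
  have h := MvN.fromBlocks_orthogonal p.isProj p.isProj.one_sub
    (by rw [mul_sub, mul_one, proj_mul p.isProj, sub_self])
    (by rw [sub_mul, one_mul, proj_mul p.isProj, sub_self])
  rw [add_sub_cancel] at h
  exact MvN.trans (p.oplus (compl p)).isProj (oneProj A p.n p.pos).isProj
    (Proj.mvN_oplus p (compl p)).symm h

/-- Equality in the Grothendieck group gives `c ⊕ p ∼₀ c` for some projection `c`. Adding the
complement of `c` to both sides replaces `c` by a unit matrix. -/
theorem K0.cls_eq_zero_iff (p : Proj A) :
    K0.cls p = 0 ↔ ∃ r : ℕ, ∃ hr : 1 ≤ r,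
      (toUnitization p).oplus (oneProj A r hr) ≈ oneProj A r hr := by
  have h0 : K0.cls p = 0 ↔ K0Unital.cls (toUnitization p) = 0 := Subtype.ext_iff
  rw [h0]
  constructor
  · intro h
    rw [← K0Unital.cls_zero 1 le_rfl, K0Unital.cls_eq_iff] at h
    obtain ⟨c, hc⟩ := h
    refine ⟨c.n, c.pos, Quotient.exact (s := Proj.setoid _) ?_⟩
    have hc' : ProjClass.mk c + ProjClass.mk (toUnitization p) = ProjClass.mk c :=
      (Quotient.sound hc).trans (Quotient.sound (Proj.oplus_zero c 1 le_rfl))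
    have hone : ProjClass.mk c + ProjClass.mk (compl c) = ProjClass.mk (oneProj A c.n c.pos) :=
      Quotient.sound (Proj.oplus_compl_equiv c)
    change ProjClass.mk (toUnitization p) + ProjClass.mk (oneProj A c.n c.pos) =
      ProjClass.mk (oneProj A c.n c.pos)
    rw [← hone, ← add_assoc, add_comm (ProjClass.mk (toUnitization p)), hc']
  · rintro ⟨r, hr, h⟩
    have := K0Unital.cls_eq h
    rwa [K0Unital.cls_oplus, add_eq_right] at this

theorem exists_coisometry_of_cls_eq_zero {p : Proj A} (hp : p.mat ≠ 0) (h : K0.cls p = 0) :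
    ∃ r : ℕ, 1 ≤ r ∧ ∃ v : Matrix (Fin r) (Fin r) (Unitization ℂ A),
      v * star v = 1 ∧ star v * v ≠ 1 := by
  obtain ⟨r, hr, h⟩ := (K0.cls_eq_zero_iff p).1 h
  refine ⟨r, hr, exists_coisometry_of_mvN (toUnitization p).isProj ?_
    (MvN.trans (isStarProjection_fromBlocks (toUnitization p).isProj (.one _))
      (oneProj A r hr).isProj (Proj.mvN_oplus _ (oneProj A r hr)) h)⟩
  intro h0
  exact hp (matrixInr_injective (h0.trans (map_zero (matrixInr A (Fin p.n))).symm))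

theorem exists_cls_eq_zero_of_coisometry {r : ℕ} (hr : 1 ≤ r)
    {v : Matrix (Fin r) (Fin r) (Unitization ℂ A)} (h1 : v * star v = 1) (h2 : star v * v ≠ 1) :
    ∃ p : Proj A, p.mat ≠ 0 ∧ K0.cls p = 0 := by
  -- The scalar part of `v` is unitary, so the defect projection has zero scalar part and lives over
  -- `A`.
  obtain ⟨a, ha⟩ : ∃ a, matrixInr A (Fin r) a = 1 - star v * v := by
    apply exists_matrixInr_eq
    rw [map_sub, map_mul, matrixFst_star, matrixFst_star_mul_self h1, map_one, sub_self]
  have hv := isStarProjection_star_mul_self h1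
  have hproj : IsStarProjection a := by
    have h := hv.one_sub
    rw [← ha] at h
    refine ⟨matrixInr_injective ?_, matrixInr_injective ?_⟩
    · rw [map_mul]; exact h.isIdempotentElem
    · rw [map_star]; exact h.isSelfAdjoint
  let p : Proj A := ⟨r, hr, a, hproj⟩
  refine ⟨p, fun h0 => h2 ?_, (K0.cls_eq_zero_iff p).2 ⟨r, hr, ?_⟩⟩
  · have ha0 : a = 0 := h0
    rw [ha0, map_zero] at ha
    exact (sub_eq_zero.1 ha.symm).symm
  · have hsum : MvN (Matrix.fromBlocks (1 - star v * v) 0 0 (star v * v))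
        (1 - star v * v + star v * v) := by
      refine MvN.fromBlocks_orthogonal hv.one_sub hv ?_ ?_
      · rw [sub_mul, one_mul, hv.isIdempotentElem, sub_self]
      · rw [mul_sub, mul_one, hv.isIdempotentElem, sub_self]
    rw [sub_add_cancel] at hsum
    have hone : IsStarProjection (1 : Matrix (Fin r) (Fin r) (Unitization ℂ A)) := .one _
    have hblock := isStarProjection_fromBlocks hv.one_sub hone
    -- The matrix `star v` implements `1 ∼₀ v*v`, and the orthogonal projections `1 - v*v` and `v*v`
    -- add up to `1`.
    have h4 : MvN (Matrix.fromBlocks (1 - star v * v) 0 0 1) 1 :=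
      MvN.trans hblock hone
        (MvN.fromBlocks (MvN.refl hv.one_sub)
          ⟨star v, by simpa [Matrix.star_eq_conjTranspose] using h1,
            by simp [Matrix.star_eq_conjTranspose]⟩) hsum
    have h3 : MvN (Matrix.fromBlocks (toUnitization p).mat 0 0 (oneProj A r hr).mat)
        (oneProj A r hr).mat := by
      change MvN (Matrix.fromBlocks (matrixInr A (Fin r) a) 0 0 1) 1
      rwa [ha]
    exact MvN.trans ((toUnitization p).oplus (oneProj A r hr)).isProj (oneProj A r hr).isProj
      (Proj.mvN_oplus (toUnitization p) (oneProj A r hr)).symm h3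

end K0

end CStarK

theorem propositionP1 (A : Type*) [NonUnitalCStarAlgebra A] :
    List.TFAE [
      ∃ p : CStarK.Proj A, p.mat ≠ 0 ∧ CStarK.K0.cls p = 0,
      ∃ r : ℕ, 1 ≤ r ∧ ∃ v : Matrix (Fin r) (Fin r) (Unitization ℂ A),
        v * star v = 1 ∧ star v * v ≠ 1,
      ¬ CStarK.IsStablyFinite A] := by
  tfae_have 1 → 2 := fun ⟨_, hp, h⟩ => CStarK.exists_coisometry_of_cls_eq_zero hp h
  tfae_have 2 → 1 := fun ⟨_, hr, _, h1, h2⟩ => CStarK.exists_cls_eq_zero_of_coisometry hr h1 h2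
  tfae_have 2 ↔ 3 := CStarK.exists_coisometry_iff_not_isStablyFinite
  tfae_finish
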